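/- Let $R$ be a noetherian commutative local ring with maximal ideal $\mathfrak m$ and countable (possibly finite) residue field $R/\mathfrak m$, and assume that $R$ is complete (and separated) for the $\mathfrak m$-adic topology. Let $M$ be a finitely generated $R$-module. Then the set of $R$-submodules of $M$ is countable (possibly finite) if and only if the following two conditions are both satisfied: (B2) $M$ has Krull dimension at most one, i.e. its support in $\operatorname{Spec} R$ has dimension $\le 1$ (the zero module being allowed); (B3) for every prime ideal $P$ of $R$ of coheight one, i.e. with $\dim(R/P)=1$, the $R$-module $(R/P)^2=(R/P)\times(R/P)$ is not isomorphic to a subquotient of $M$, i.e. to a module $L/N$ with $N\subseteq L\subseteq M$ submodules. If (B2) and (B3) are not both satisfied, then the set of submodules of $M$ has cardinality exactly $2^{\aleph_0}$. -/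

import Mathlib

/-- An `R`-module `X` is (isomorphic to) a subquotient of `M` if there is a submodule `L` of `M`
and a submodule `N` of `L` such that `X` is isomorphic to `L / N`. -/
def IsSubquotient (R : Type*) [Ring R] (X M : Type*) [AddCommGroup X] [Module R X]
    [AddCommGroup M] [Module R M] : Prop :=
  ∃ (L : Submodule R M) (N : Submodule R L), Nonempty (X ≃ₗ[R] (L ⧸ N))

/-! For `x` in the maximal ideal, the sums `∑ ε i * x ^ i` over binary sequences form a Cantor set
in `R` whose nonzero differences are units times powers of `x`. If (B3) fails, graphs of
multiplication by these sums are distinct submodules of `(R/P)²`. If (B2) fails, some `R/P` with `P`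
in the support has dimension at least two, and the principal ideals generated by `x + s ε * y` are
distinct there, by Krull's height theorem. Submodules of a subquotient inject into those of `M`, and
`2^ℵ₀` is always an upper bound. Conversely, Noetherian induction allows the assumption that every
nonzero submodule lies in only countably many others. Embed some `R/P` in `M` with image `K`. A
submodule meeting `K` nontrivially contains one of the countably many nonzero submodules of `K`. One
meeting `K` trivially is a complement of `K` in one of countably many `L ⊇ K`, and by (B3)
complements are scarce. -/

/-! ### Binary power series in a complete local ring -/

theorem IsAdicComplete.exists_digit_sum {R : Type*} [CommRing R] (I : Ideal R)
    [IsAdicComplete I R] {x : R} (hx : x ∈ I) :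
    ∃ s : (ℕ → Bool) → R,
      ∀ ε, s ε = (if ε 0 then 1 else 0) + x * s (fun n => ε (n + 1)) := by
  let p : (ℕ → Bool) → ℕ → R := fun ε n =>
    ∑ i ∈ Finset.range n, (if ε i then 1 else 0) * x ^ i
  have hp : ∀ ε, ∃ L : R, ∀ n, p ε n - L ∈ I ^ n := by
    intro ε
    obtain ⟨L, hL⟩ := IsPrecomplete.prec' (I := I) (M := R) (p ε) (by
      intro m n hmn
      rw [SModEq.comm, SModEq.sub_mem, smul_eq_mul, Ideal.mul_top]
      simp only [p]
      rw [← Finset.sum_Ico_eq_sub _ hmn]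
      refine Ideal.sum_mem _ fun i hi => Ideal.mul_mem_left _ _ ?_
      exact Ideal.pow_le_pow_right (Finset.mem_Ico.1 hi).1 (Ideal.pow_mem_pow hx i))
    refine ⟨L, fun n => ?_⟩
    have := hL n
    rwa [SModEq.sub_mem, smul_eq_mul, Ideal.mul_top] at this
  choose s hs using hp
  refine ⟨s, fun ε => ?_⟩
  rw [← sub_eq_zero]
  refine IsHausdorff.haus' (I := I) _ fun n => ?_
  rw [SModEq.zero, smul_eq_mul, Ideal.mul_top]
  -- Splitting off the first digit turns a partial sum of length `n + 1` into one of length `n` for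
  -- the shifted sequence.
  have h1 := Ideal.pow_le_pow_right (Nat.le_succ n) (hs ε (n + 1))
  have h2 := Ideal.mul_mem_left _ x (hs (fun n => ε (n + 1)) n)
  have h3 : p ε (n + 1) = (if ε 0 then 1 else 0) + x * p (fun n => ε (n + 1)) n := by
    simp only [p]
    rw [Finset.sum_range_succ', Finset.mul_sum, add_comm]
    congr 1
    · simp
    · exact Finset.sum_congr rfl fun i _ => by ring
  rw [h3] at h1
  have := (I ^ n).sub_mem h2 h1
  convert this using 1
  ring

/-- A Cantor set in a complete local ring, with differences controlled by powers of `x`. -/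
theorem IsLocalRing.exists_digit_sum_sub {R : Type*} [CommRing R] [IsLocalRing R]
    [IsAdicComplete (IsLocalRing.maximalIdeal R) R] {x : R}
    (hx : x ∈ IsLocalRing.maximalIdeal R) :
    ∃ s : (ℕ → Bool) → R, ∀ ε δ, ε ≠ δ →
      ∃ (n : ℕ) (u : R), IsUnit u ∧ s ε - s δ = x ^ n * u := by
  obtain ⟨s, hs⟩ := IsAdicComplete.exists_digit_sum _ hx
  refine ⟨s, fun ε δ h => ?_⟩
  obtain ⟨n, hn⟩ := Function.ne_iff.1 h
  clear h
  have key : ∀ r : R, IsUnit (1 + x * r) := fun r => by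
    by_contra hu
    have h1 : 1 + x * r ∈ IsLocalRing.maximalIdeal R := hu
    exact (IsLocalRing.maximalIdeal.isMaximal R).ne_top ((Ideal.eq_top_iff_one _).2
      ((Ideal.add_mem_iff_left _ (Ideal.mul_mem_right r _ hx)).1 h1))
  have base : ∀ ε δ : ℕ → Bool, ε 0 ≠ δ 0 →
      ∃ (n : ℕ) (u : R), IsUnit u ∧ s ε - s δ = x ^ n * u := by
    intro ε δ h
    refine ⟨0, s ε - s δ, ?_, by simp⟩
    rw [hs ε, hs δ]
    cases h1 : ε 0 <;> cases h2 : δ 0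
    · simp [h1, h2] at h
    · rw [← IsUnit.neg_iff]
      convert key (s (fun n => δ (n + 1)) - s (fun n => ε (n + 1))) using 1
      simp; ring
    · convert key (s (fun n => ε (n + 1)) - s (fun n => δ (n + 1))) using 1
      simp; ring
    · simp [h1, h2] at h
  induction n generalizing ε δ with
  | zero => exact base ε δ hn
  | succ n ih =>
    by_cases h0 : ε 0 = δ 0
    · obtain ⟨m, u, hu, h⟩ := ih (fun n => ε (n + 1)) (fun n => δ (n + 1)) hn
      refine ⟨m + 1, u, hu, ?_⟩
      rw [hs ε, hs δ, h0, pow_succ', mul_assoc, ← h]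
      ring
    · exact base ε δ h0

/-! ### Subquotients -/

/-- The preimage under `f` of the copy of `X` in `Y` maps onto `X`. The range of `f` itself need not
be identified. -/
theorem IsSubquotient.of_linearMap {R X M Y : Type*} [Ring R] [AddCommGroup X] [Module R X]
    [AddCommGroup M] [Module R M] [AddCommGroup Y] [Module R Y] (L : Submodule R M)
    (f : L →ₗ[R] Y) (g : X →ₗ[R] Y) (hg : Function.Injective g)
    (h : LinearMap.range g ≤ LinearMap.range f) : IsSubquotient R X M := by
  let L' : Submodule R M := ((LinearMap.range g).comap f).map L.subtype
  let i : L' →ₗ[R] L := Submodule.inclusion (Submodule.map_subtype_le _ _)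
  have hi : ∀ y : L', f (i y) ∈ LinearMap.range g := by
    rintro ⟨_, y, hy, rfl⟩
    exact hy
  let F : L' →ₗ[R] X :=
    (LinearEquiv.ofInjective g hg).symm.toLinearMap ∘ₗ (f ∘ₗ i).codRestrict _ hi
  have hF : Function.Surjective F := by
    intro x
    obtain ⟨y, hy⟩ := h ⟨x, rfl⟩
    refine ⟨⟨y.1, y, ?_, rfl⟩, ?_⟩
    · exact ⟨x, hy.symm⟩
    · apply (LinearEquiv.ofInjective g hg).injective
      ext
      simp only [F, LinearMap.comp_apply, LinearEquiv.coe_coe, LinearEquiv.apply_symm_apply]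
      exact hy
  exact ⟨L', LinearMap.ker F, ⟨(F.quotKerEquivOfSurjective hF).symm⟩⟩

theorem IsSubquotient.exists_surjective {R X M : Type*} [Ring R] [AddCommGroup X] [Module R X]
    [AddCommGroup M] [Module R M] (h : IsSubquotient R X M) :
    ∃ (L : Submodule R M) (f : L →ₗ[R] X), Function.Surjective f := by
  obtain ⟨L, N, ⟨e⟩⟩ := h
  exact ⟨L, e.symm.toLinearMap ∘ₗ N.mkQ, e.symm.surjective.comp N.mkQ_surjective⟩

theorem IsSubquotient.of_quotient {R X M : Type*} [Ring R] [AddCommGroup X] [Module R X]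
    [AddCommGroup M] [Module R M] {N : Submodule R M} (h : IsSubquotient R X (M ⧸ N)) :
    IsSubquotient R X M := by
  obtain ⟨L, f, hf⟩ := h.exists_surjective
  let q : L.comap N.mkQ →ₗ[R] L := N.mkQ.restrict fun _ hx => hx
  refine .of_linearMap (L.comap N.mkQ) (f ∘ₗ q) LinearMap.id Function.injective_id ?_
  rintro x -
  obtain ⟨⟨y, hy⟩, rfl⟩ := hf x
  obtain ⟨m, rfl⟩ := N.mkQ_surjective y
  exact ⟨⟨m, hy⟩, rfl⟩

theorem IsSubquotient.exists_submodule_injective {R X M : Type*} [Ring R] [AddCommGroup X]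
    [Module R X] [AddCommGroup M] [Module R M] (h : IsSubquotient R X M) :
    ∃ φ : Submodule R X → Submodule R M, Function.Injective φ := by
  obtain ⟨L, f, hf⟩ := h.exists_surjective
  exact ⟨fun N => (N.comap f).map L.subtype,
    (Submodule.map_injective_of_injective L.injective_subtype).comp
      (Submodule.comap_injective_of_surjective hf)⟩

theorem isSubquotient_quotient_of_mem_support {R M : Type*} [CommRing R] [AddCommGroup M]
    [Module R M] {p : PrimeSpectrum R} (hp : p ∈ Module.support R M) :
    IsSubquotient R (R ⧸ p.asIdeal) M := by
  obtain ⟨m, hm⟩ := Module.mem_support_iff_exists_annihilator.1 hp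
  let e := LinearMap.quotKerEquivRange (LinearMap.toSpanSingleton R M m)
  have hk : LinearMap.ker (LinearMap.toSpanSingleton R M m) ≤ p.asIdeal := by
    intro r hr
    exact hm ((Submodule.mem_annihilator_span_singleton m r).2 (by simpa using hr))
  refine .of_linearMap _ (Submodule.factor hk ∘ₗ e.symm.toLinearMap) LinearMap.id
    Function.injective_id ?_
  rintro x -
  obtain ⟨y, rfl⟩ := Submodule.factor_surjective hk x
  exact ⟨e y, by simp⟩

/-! ### Countability of finite length modules and the upper bound -/

theorem IsLocalRing.countable_of_maximalIdeal_smul_eq_bot {R X : Type*} [CommRing R] [IsLocalRing R]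
    [Countable (IsLocalRing.ResidueField R)] [AddCommGroup X] [Module R X] [Module.Finite R X]
    (h : ∀ r ∈ IsLocalRing.maximalIdeal R, ∀ x : X, r • x = 0) : Countable X := by
  obtain ⟨n, g, hg⟩ := Module.Finite.exists_fin (R := R) (M := X)
  choose l hl using IsLocalRing.residue_surjective (R := R)
  refine Function.Surjective.countable
    (f := fun c : Fin n → IsLocalRing.ResidueField R => ∑ i, l (c i) • g i) fun x => ?_
  have hx : x ∈ Submodule.span R (Set.range g) := hg ▸ Submodule.mem_top
  obtain ⟨c, rfl⟩ := (Submodule.mem_span_range_iff_exists_fun R).1 hx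
  refine ⟨fun i => IsLocalRing.residue R (c i), Finset.sum_congr rfl fun i _ => ?_⟩
  rw [← sub_eq_zero, ← sub_smul]
  refine h _ ?_ _
  rw [← IsLocalRing.residue_eq_zero_iff, map_sub, hl, sub_self]

theorem IsLocalRing.countable_of_maximalIdeal_pow_smul_eq_bot {R X : Type*} [CommRing R]
    [IsLocalRing R] [IsNoetherianRing R] [Countable (IsLocalRing.ResidueField R)]
    [AddCommGroup X] [Module R X] [Module.Finite R X] (n : ℕ)
    (h : IsLocalRing.maximalIdeal R ^ n • (⊤ : Submodule R X) = ⊥) : Countable X := by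
  induction n generalizing X with
  | zero =>
    have : Subsingleton X := by
      rw [← Submodule.subsingleton_iff R, ← subsingleton_iff_bot_eq_top, ← h]
      simp
    infer_instance
  | succ n ih =>
    let N : Submodule R X := IsLocalRing.maximalIdeal R ^ n • ⊤
    have h1 : Countable N := by
      refine IsLocalRing.countable_of_maximalIdeal_smul_eq_bot (R := R) fun r hr x => ?_
      have : r • (x : X) ∈ IsLocalRing.maximalIdeal R • N := Submodule.smul_mem_smul hr x.2
      rw [← Submodule.mul_smul, ← pow_succ', h, Submodule.mem_bot] at this
      exact Subtype.ext this
    have h2 : Countable (X ⧸ N) := by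
      refine ih (X := X ⧸ N) ?_
      rw [← Submodule.range_mkQ N, ← Submodule.map_top, ← Submodule.map_smul'',
        ← LinearMap.le_ker_iff_map]
      exact (Submodule.ker_mkQ N).ge
    exact (AddSubgroup.addGroupEquivQuotientProdAddSubgroup
      (s := N.toAddSubgroup)).injective.countable (β := (X ⧸ N) × N)

theorem Submodule.countable_of_countable {R X : Type*} [Ring R] [AddCommGroup X] [Module R X]
    [IsNoetherian R X] [Countable X] : Countable (Submodule R X) := by
  refine Function.Surjective.countable (f := fun s : Finset X => Submodule.span R (s : Set X))
    fun N => ?_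
  exact IsNoetherian.noetherian N

theorem IsLocalRing.countable_quotient_pow {R : Type*} [CommRing R] [IsLocalRing R]
    [IsNoetherianRing R] [Countable (IsLocalRing.ResidueField R)] (n : ℕ) :
    Countable (R ⧸ IsLocalRing.maximalIdeal R ^ n) := by
  refine IsLocalRing.countable_of_maximalIdeal_pow_smul_eq_bot (R := R) n ?_
  rw [← Submodule.range_mkQ, ← Submodule.map_top, ← Submodule.map_smul'',
    ← LinearMap.le_ker_iff_map, smul_eq_mul, Ideal.mul_top, Submodule.ker_mkQ]

open Cardinal in
-- Separatedness embeds `R` in the product of the countable rings `R/𝔪ⁿ`, and each submodule is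
-- spanned by a sequence in `M`.
theorem IsLocalRing.mk_submodule_le_continuum {R M : Type*} [CommRing R]
    [IsLocalRing R] [IsNoetherianRing R] [Countable (IsLocalRing.ResidueField R)]
    [IsHausdorff (IsLocalRing.maximalIdeal R) R] [AddCommGroup M] [Module R M]
    [Module.Finite R M] : #(Submodule R M) ≤ 𝔠 := by
  have h1 : ∃ f : R → ℕ → ℕ, Function.Injective f := by
    have := IsLocalRing.countable_quotient_pow (R := R)
    choose e he using fun n : ℕ => (countable_iff_exists_injective _).1 (this n)
    refine ⟨fun r n => e n (Ideal.Quotient.mk _ r), fun r s hrs => ?_⟩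
    rw [← sub_eq_zero]
    refine IsHausdorff.haus' (I := IsLocalRing.maximalIdeal R) _ fun n => ?_
    rw [SModEq.zero, smul_eq_mul, Ideal.mul_top]
    exact Ideal.Quotient.eq.1 (he n (congrFun hrs n))
  obtain ⟨f, hf⟩ := h1
  have hσ := Function.invFun_surjective hf
  set σ := Function.invFun f
  obtain ⟨n, g, hg⟩ := Module.Finite.exists_fin (R := R) (M := M)
  let τ : (ℕ → ℕ → ℕ) → M := fun c => ∑ i : Fin n, σ (c i) • g i
  have hτ : Function.Surjective τ := fun x => by
    have hx : x ∈ Submodule.span R (Set.range g) := hg ▸ Submodule.mem_top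
    obtain ⟨c, rfl⟩ := (Submodule.mem_span_range_iff_exists_fun R).1 hx
    choose d hd using fun i => hσ (c i)
    refine ⟨fun i => if h : i < n then d ⟨i, h⟩ else 0, ?_⟩
    simp [τ, hd]
  have hF : Function.Surjective
      (fun c : ℕ → ℕ → ℕ → ℕ => Submodule.span R (Set.range fun i => τ (c i))) := fun N => by
    obtain ⟨s, hs⟩ := (IsNoetherian.noetherian N : N.FG)
    -- Adjoining `0` makes the generating set nonempty, hence the range of a sequence, without
    -- changing its span.
    obtain ⟨a, ha⟩ := ((s.countable_toSet).insert 0).exists_eq_range (Set.insert_nonempty _ _)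
    choose c hc using fun i => hτ (a i)
    refine ⟨c, ?_⟩
    simp only [hc]
    rw [← ha, Submodule.span_insert_zero, hs]
  have := Cardinal.lift_mk_le_lift_mk_of_surjective hF
  simpa using this

open Cardinal in
theorem Cardinal.continuum_le_mk_of_injective {α : Type*} {f : (ℕ → Bool) → α}
    (hf : Function.Injective f) : 𝔠 ≤ #α := by
  simpa using Cardinal.lift_mk_le_lift_mk_of_injective hf

/-! ### Uncountable families of submodules -/

/-- The graphs of multiplication by elements of `R` give uncountably many submodules. -/
theorem IsLocalRing.exists_injective_submodule_prod {R : Type*} [CommRing R] [IsLocalRing R]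
    [IsAdicComplete (IsLocalRing.maximalIdeal R) R] {P : Ideal R} [P.IsPrime]
    (hP : P ≠ IsLocalRing.maximalIdeal R) :
    ∃ f : (ℕ → Bool) → Submodule R ((R ⧸ P) × (R ⧸ P)), Function.Injective f := by
  obtain ⟨x, hx, hxP⟩ := SetLike.exists_of_lt
    ((IsLocalRing.le_maximalIdeal (Ideal.IsPrime.ne_top ‹P.IsPrime›)).lt_of_ne hP)
  obtain ⟨s, hs⟩ := IsLocalRing.exists_digit_sum_sub hx
  refine ⟨fun ε => LinearMap.graph (s ε • (LinearMap.id : (R ⧸ P) →ₗ[R] (R ⧸ P))),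
    fun ε δ h => ?_⟩
  by_contra hne
  obtain ⟨n, u, hu, h2⟩ := hs ε δ hne
  have h3 : ((1 : R ⧸ P), s ε • (1 : R ⧸ P)) ∈
      LinearMap.graph (s δ • (LinearMap.id : (R ⧸ P) →ₗ[R] (R ⧸ P))) := by
    refine h.le ?_
    simp [LinearMap.mem_graph_iff]
  simp only [LinearMap.mem_graph_iff, LinearMap.smul_apply, LinearMap.id_apply] at h3
  rw [← sub_eq_zero, ← sub_smul, h2, Algebra.smul_def, mul_one, Ideal.Quotient.algebraMap_eq,
    Ideal.Quotient.eq_zero_iff_mem] at h3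
  rcases Ideal.IsPrime.mem_or_mem ‹_› h3 with h | h
  · exact hxP (Ideal.IsPrime.mem_of_pow_mem ‹_› _ h)
  · exact Ideal.IsPrime.ne_top ‹P.IsPrime› (Ideal.eq_top_of_isUnit_mem _ h hu)

theorem Ideal.two_le_height_of_bot_lt_of_lt {D : Type*} [CommRing D] [IsDomain D]
    {p q : Ideal D} [p.IsPrime] [q.IsPrime] (hp : p ≠ ⊥) (hpq : p < q) :
    ¬ q.height ≤ 1 := by
  intro h
  have h1 : p.height + 1 ≤ q.height := Ideal.height_add_one_le_of_lt_of_isPrime hpq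
  have h2 : (⊥ : Ideal D).height + 1 ≤ p.height :=
    Ideal.height_add_one_le_of_lt_of_isPrime (bot_lt_iff_ne_bot.2 hp)
  have h3 : (1 : ℕ∞) + 1 ≤ 1 := by
    refine le_trans ?_ (h1.trans h)
    gcongr
    exact le_trans (by simp) h2
  exact absurd h3 (by decide)

/-- In a prime of height at least two there are two elements not both contained in a prime of
height at most one. -/
theorem Ideal.exists_not_height_le_one {D : Type*} [CommRing D] [IsDomain D] [IsNoetherianRing D]
    {p q : Ideal D} [p.IsPrime] [q.IsPrime] (hp : p ≠ ⊥) (hpq : p < q) :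
    ∃ x ∈ q, ∃ y ∈ q, ∀ r : Ideal D, r.IsPrime → x ∈ r → y ∈ r → ¬ r.height ≤ 1 := by
  obtain ⟨x, hxp, hx⟩ := Submodule.exists_mem_ne_zero_of_ne_bot hp
  have hfin := (Ideal.span {x}).finite_minimalPrimes_of_isNoetherianRing
  -- Prime avoidance: the finitely many minimal primes over `x` have height at most one, so none
  -- contains `q`.
  have hq : ¬ ((q : Set D) ⊆ ⋃ i ∈ (↑hfin.toFinset : Set (Ideal D)), (i : Set D)) := by
    rw [Ideal.subset_union_prime (f := fun i : Ideal D => i) ⊥ ⊥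
      (fun i hi _ _ => (hfin.mem_toFinset.1 hi).1.1)]
    rintro ⟨i, hi, hqi⟩
    replace hi := hfin.mem_toFinset.1 hi
    have := hi.1.1
    exact two_le_height_of_bot_lt_of_lt hp (hpq.trans_le hqi)
      (Ideal.height_le_one_of_isPrincipal_of_mem_minimalPrimes _ i hi)
  obtain ⟨y, hyq, hy⟩ := Set.not_subset.1 hq
  refine ⟨x, hpq.le hxp, y, hyq, fun r hr hxr hyr => ?_⟩
  obtain ⟨i, hi, hir⟩ := Ideal.exists_minimalPrimes_le
    (I := Ideal.span {x}) (J := r) (by rwa [Ideal.span_singleton_le_iff_mem])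
  have := hi.1.1
  have hi0 : i ≠ ⊥ := by
    rintro rfl
    exact hx (by simpa using hi.1.2)
  refine two_le_height_of_bot_lt_of_lt hi0 (hir.lt_of_ne ?_)
  rintro rfl
  exact hy (Set.mem_biUnion (hfin.mem_toFinset.2 hi) hyr)

/-- If two of the generators `x + s ε • y` spanned the same ideal, a minimal prime over it would
contain their difference, a unit times `y ^ (n + 1)`, hence `y` and then `x`. Its height is at most
one, against the choice of `x` and `y`. -/
theorem IsLocalRing.exists_injective_submodule_of_not_krullDimLE {R : Type*} [CommRing R]
    [IsLocalRing R] [IsNoetherianRing R] [IsAdicComplete (IsLocalRing.maximalIdeal R) R]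
    {P : Ideal R} [P.IsPrime] (hP : ¬ Ring.KrullDimLE 1 (R ⧸ P)) :
    ∃ f : (ℕ → Bool) → Submodule R (R ⧸ P), Function.Injective f := by
  rw [Ring.krullDimLE_one_iff_of_noZeroDivisors] at hP
  push Not at hP
  obtain ⟨p, hp0, hp, hpm⟩ := hP
  obtain ⟨q, hq, hpq⟩ := Ideal.exists_le_maximal p hp.ne_top
  have hlt : p < q := hpq.lt_of_ne fun h => hpm (h ▸ hq)
  have := hq.isPrime
  obtain ⟨x, hx, y, hy, hxy⟩ := Ideal.exists_not_height_le_one hp0 hlt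
  obtain ⟨y, rfl⟩ := Ideal.Quotient.mk_surjective y
  have hym : y ∈ IsLocalRing.maximalIdeal R :=
    IsLocalRing.le_maximalIdeal (Ideal.IsPrime.ne_top (I := q.comap (Ideal.Quotient.mk P))
      inferInstance) hy
  obtain ⟨s, hs⟩ := IsLocalRing.exists_digit_sum_sub hym
  refine ⟨fun ε => Submodule.span R {x + s ε • Ideal.Quotient.mk P y}, fun ε δ h => ?_⟩
  by_contra hne
  obtain ⟨n, u, hu, h2⟩ := hs ε δ hne
  set z := x + s δ • Ideal.Quotient.mk P y with hz
  have hzq : z ∈ q := by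
    rw [hz, Algebra.smul_def]
    exact q.add_mem hx (q.mul_mem_left _ hy)
  obtain ⟨r, hr, -⟩ := Ideal.exists_minimalPrimes_le
    (I := Ideal.span {z}) (J := q) (by rwa [Ideal.span_singleton_le_iff_mem])
  have hrp := hr.1.1
  have hzr : z ∈ r := (Ideal.span_singleton_le_iff_mem _).1 hr.1.2
  have h3 : x + s ε • Ideal.Quotient.mk P y ∈ r := by
    have : x + s ε • Ideal.Quotient.mk P y ∈ Submodule.span R {z} := by
      exact h.le (Submodule.mem_span_singleton_self _)
    obtain ⟨c, hc⟩ := Submodule.mem_span_singleton.1 this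
    rw [← hc, Algebra.smul_def]
    exact r.mul_mem_left _ hzr
  have h4 : Ideal.Quotient.mk P y ∈ r := by
    have h5 := r.sub_mem h3 hzr
    rw [hz, add_sub_add_left_eq_sub, ← sub_smul, h2, Algebra.smul_def, map_mul, map_pow,
      Ideal.Quotient.algebraMap_eq, mul_right_comm] at h5
    rcases hrp.mem_or_mem h5 with h6 | h6
    · rw [← pow_succ] at h6
      exact hrp.mem_of_pow_mem _ h6
    · exact absurd (Ideal.eq_top_of_isUnit_mem _ h6 (hu.map _)) hrp.ne_top
  have h5 : x ∈ r := by
    have := r.sub_mem hzr (r.mul_mem_left (algebraMap R _ (s δ)) h4)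
    rwa [hz, Algebra.smul_def, add_sub_cancel_right] at this
  exact hxy r hrp h5 h4 (Ideal.height_le_one_of_isPrincipal_of_mem_minimalPrimes _ r hr)

theorem Module.exists_isSubquotient_not_krullDimLE_one {R M : Type*} [CommRing R] [AddCommGroup M]
    [Module R M] (h : ¬ Module.supportDim R M ≤ 1) :
    ∃ P : Ideal R, P.IsPrime ∧ IsSubquotient R (R ⧸ P) M ∧ ¬ Ring.KrullDimLE 1 (R ⧸ P) := by
  have h2 : ((2 : ℕ) : WithBot ℕ∞) ≤ Order.krullDim (Module.support R M) := by
    by_contra h3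
    rw [not_le, show ((2 : ℕ) : WithBot ℕ∞) = 1 + 1 by norm_num] at h3
    exact h (ENat.WithBot.lt_add_one_iff.1 h3)
  obtain ⟨l, hl⟩ := Order.le_krullDim_iff.1 h2
  refine ⟨(l 0).1.asIdeal, (l 0).1.isPrime, isSubquotient_quotient_of_mem_support (l 0).2, ?_⟩
  intro hk
  rw [Ring.krullDimLE_iff, ringKrullDim_quotient] at hk
  have hmem : ∀ i, (l i).1 ∈ PrimeSpectrum.zeroLocus ((l 0).1.asIdeal : Set R) := fun i =>
    l.monotone (Fin.zero_le i)
  let l' : LTSeries (PrimeSpectrum.zeroLocus ((l 0).1.asIdeal : Set R)) :=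
    { length := l.length
      toFun := fun i => ⟨(l i).1, hmem i⟩
      step := fun i => l.step i }
  have h4 := (Order.le_krullDim_iff (n := 2)).2 ⟨l', hl⟩
  exact absurd (h4.trans hk) (by decide)

/-! ### Countability under (B2) and (B3) -/

/-- Any ideal strictly above `P` contains a power of `𝔪`, and each `R/𝔪ⁿ` is countable and
Noetherian. -/
theorem IsLocalRing.countable_Ioi_of_krullDimLE_one {R : Type*} [CommRing R] [IsLocalRing R]
    [IsNoetherianRing R] [Countable (IsLocalRing.ResidueField R)] {P : Ideal R} [P.IsPrime]
    (hP : Ring.KrullDimLE 1 (R ⧸ P)) : (Set.Ioi P).Countable := by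
  have hsub : Set.Ioi P ⊆ ⋃ n : ℕ, Set.Ici (IsLocalRing.maximalIdeal R ^ n) := by
    intro J (hJ : P < J)
    have hrad : IsLocalRing.maximalIdeal R ≤ J.radical := by
      rw [Ideal.radical_eq_sInf]
      refine le_sInf fun Q ⟨hJQ, hQ⟩ => ?_
      have hk : RingHom.ker (Ideal.Quotient.mk P) ≤ Q := by
        rw [Ideal.mk_ker]; exact hJ.le.trans hJQ
      have hQ' := Ideal.map_isPrime_of_surjective Ideal.Quotient.mk_surjective hk
      have hne : Q.map (Ideal.Quotient.mk P) ≠ ⊥ := by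
        rw [Ne, Ideal.map_eq_bot_iff_le_ker, Ideal.mk_ker]
        exact fun h => (hJ.trans_le hJQ).not_ge h
      have hmax := Ring.krullDimLE_one_iff_of_noZeroDivisors.1 hP _ hne hQ'
      have h2 := Ideal.comap_isMaximal_of_surjective _
        Ideal.Quotient.mk_surjective (K := Q.map (Ideal.Quotient.mk P))
      rw [Ideal.comap_map_of_surjective' _ Ideal.Quotient.mk_surjective,
        sup_eq_left.2 hk] at h2
      exact (IsLocalRing.eq_maximalIdeal h2).ge
    obtain ⟨n, hn⟩ := J.exists_radical_pow_le_of_fg (IsNoetherian.noetherian _)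
    exact Set.mem_iUnion.2 ⟨n, (Ideal.pow_right_mono hrad n).trans hn⟩
  refine (Set.countable_iUnion fun n => ?_).mono hsub
  have := IsLocalRing.countable_quotient_pow (R := R) n
  have := Submodule.countable_of_countable (R := R) (X := R ⧸ IsLocalRing.maximalIdeal R ^ n)
  exact (Submodule.comapMkQRelIso (IsLocalRing.maximalIdeal R ^ n)).symm.injective.countable

theorem LinearMap.countable_of_finite {R L p : Type*} [CommRing R] [AddCommGroup L] [Module R L]
    [Module.Finite R L] [AddCommGroup p] [Module R p] [Countable p] : Countable (L →ₗ[R] p) := by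
  obtain ⟨n, g, hg⟩ := Module.Finite.exists_fin (R := R) (M := L)
  refine Function.Injective.countable (f := fun (h : L →ₗ[R] p) i => h (g i)) fun a b hab => ?_
  exact LinearMap.ext_on_range hg (congrFun hab)

/-- Two distinct complements of a copy of the domain `R ⧸ P` produce a copy of `(R ⧸ P) ^ 2`. -/
theorem Submodule.subsingleton_isCompl {R L : Type*} [CommRing R] [AddCommGroup L] [Module R L]
    {P : Ideal R} [P.IsPrime] {p : Submodule R L} (e : (R ⧸ P) ≃ₗ[R] p)
    (h : ¬ IsSubquotient R ((R ⧸ P) × (R ⧸ P)) L) : Subsingleton {q // IsCompl p q} := by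
  refine @Function.Injective.subsingleton _ _ _ p.isComplEquivProj.injective ⟨?_⟩
  rintro ⟨f, hf⟩ ⟨g, hg⟩
  by_contra hne
  have hfg : ∃ x, g x - f x ≠ 0 := by
    by_contra! hx
    exact hne (Subtype.ext (LinearMap.ext fun x => (sub_eq_zero.1 (hx x)).symm))
  obtain ⟨x, hx⟩ := hfg
  -- For distinct projections `f`, `g` onto `p`, the range of `(f, g - f)` contains `R/P × a(R/P)`
  -- with `a ≠ 0`, which is a copy of `(R/P)²`.
  let F : L →ₗ[R] (R ⧸ P) × (R ⧸ P) :=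
    (e.symm.toLinearMap ∘ₗ f).prod (e.symm.toLinearMap ∘ₗ (g - f))
  let a : R ⧸ P := e.symm (g x - f x)
  have ha : a ≠ 0 := e.symm.map_ne_zero_iff.2 hx
  let G : (R ⧸ P) × (R ⧸ P) →ₗ[R] (R ⧸ P) × (R ⧸ P) :=
    LinearMap.prodMap LinearMap.id (LinearMap.mulLeft R a)
  have hG : Function.Injective G := by
    rintro ⟨u, v⟩ ⟨u', v'⟩ huv
    simp only [G, LinearMap.prodMap_apply, LinearMap.id_apply, LinearMap.mulLeft_apply,
      Prod.mk.injEq] at huv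
    rw [huv.1, mul_left_cancel₀ ha huv.2]
  refine h (.of_linearMap ⊤ (F ∘ₗ (⊤ : Submodule R L).subtype) G hG ?_)
  rintro _ ⟨⟨u, v⟩, rfl⟩
  obtain ⟨v, rfl⟩ := Ideal.Quotient.mk_surjective v
  -- Both projections fix `p`, so `f` kills `x - f x` while `g` sends it to `g x - f x`.
  let y : L := v • (x - f x) + e u
  have h1 : f y = e u := by
    simp [y, hf]
  have h2 : g y = v • (g x - f x) + e u := by
    simp [y, hg]
  refine ⟨⟨y, trivial⟩, Prod.ext ?_ ?_⟩
  · change e.symm (f y) = u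
    rw [h1, LinearEquiv.symm_apply_apply]
  · change e.symm (g y - f y) = a * Ideal.Quotient.mk P v
    rw [h1, h2, add_sub_cancel_right, map_smul, Algebra.smul_def, mul_comm]
    rfl

theorem Ideal.ringKrullDim_quotient_eq_one {R : Type*} [CommRing R] {P : Ideal R} [P.IsPrime]
    (hP : Ring.KrullDimLE 1 (R ⧸ P)) (hm : ¬ P.IsMaximal) : ringKrullDim (R ⧸ P) = 1 := by
  refine le_antisymm (by simpa using (Ring.krullDimLE_iff).1 hP) ?_
  by_contra h
  have h0 : ringKrullDim (R ⧸ P) ≤ ((0 : ℕ) : WithBot ℕ∞) := by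
    rw [not_le, show (1 : WithBot ℕ∞) = ((0 : ℕ) : WithBot ℕ∞) + 1 by norm_num] at h
    exact ENat.WithBot.lt_add_one_iff.1 h
  have := Ring.krullDimLE_zero_iff.1 (Ring.krullDimLE_iff.2 h0) ⊥ Ideal.isPrime_bot
  exact hm ((Ideal.bot_quotient_isMaximal_iff P).1 this)

/-- Complements of `p` correspond to projections onto `p`. For `P` maximal, `p` is countable and so
is `Hom(L, p)`; otherwise `P` has coheight one and there is at most one complement. -/
theorem IsLocalRing.countable_isCompl {R L : Type*} [CommRing R] [IsLocalRing R]
    [IsNoetherianRing R] [Countable (IsLocalRing.ResidueField R)] [AddCommGroup L] [Module R L]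
    [Module.Finite R L] {P : Ideal R} [P.IsPrime] (hP : Ring.KrullDimLE 1 (R ⧸ P))
    {p : Submodule R L} (e : (R ⧸ P) ≃ₗ[R] p)
    (h : ringKrullDim (R ⧸ P) = 1 → ¬ IsSubquotient R ((R ⧸ P) × (R ⧸ P)) L) :
    Countable {q // IsCompl p q} := by
  by_cases hm : P.IsMaximal
  · have : Countable (R ⧸ P) := by
      rw [IsLocalRing.eq_maximalIdeal hm]
      assumption
    have : Countable p := e.symm.injective.countable
    have := LinearMap.countable_of_finite (R := R) (L := L) (p := p)
    exact p.isComplEquivProj.injective.countable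
  · have := Submodule.subsingleton_isCompl e (h (Ideal.ringKrullDim_quotient_eq_one hP hm))
    infer_instance

theorem IsSubquotient.of_submodule {R X M : Type*} [Ring R] [AddCommGroup X] [Module R X]
    [AddCommGroup M] [Module R M] {L : Submodule R M} (h : IsSubquotient R X L) :
    IsSubquotient R X M := by
  obtain ⟨L', f, hf⟩ := h.exists_surjective
  let e := L'.equivMapOfInjective L.subtype L.injective_subtype
  refine .of_linearMap (L'.map L.subtype) (f ∘ₗ e.symm.toLinearMap) LinearMap.id
    Function.injective_id ?_
  rintro x -
  obtain ⟨y, rfl⟩ := hf x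
  exact ⟨e y, by simp⟩

theorem IsLocalRing.countable_submodule_of_countable_Ici {R M : Type*} [CommRing R] [IsLocalRing R]
    [IsNoetherianRing R] [Countable (IsLocalRing.ResidueField R)] [AddCommGroup M] [Module R M]
    [Module.Finite R M] {P : Ideal R} [P.IsPrime] (hP : Ring.KrullDimLE 1 (R ⧸ P))
    (f : (R ⧸ P) →ₗ[R] M) (hf : Function.Injective f)
    (h : ringKrullDim (R ⧸ P) = 1 → ¬ IsSubquotient R ((R ⧸ P) × (R ⧸ P)) M)
    (hM : ∀ K : Submodule R M, K ≠ ⊥ → (Set.Ici K).Countable) : Countable (Submodule R M) := by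
  set K := LinearMap.range f with hK
  have hK0 : K ≠ ⊥ := by
    rw [hK, Ne, LinearMap.range_eq_bot]
    rintro rfl
    exact one_ne_zero (hf (by simp : (0 : (R ⧸ P) →ₗ[R] M) 1 = (0 : (R ⧸ P) →ₗ[R] M) 0))
  have hI : {I : Submodule R (R ⧸ P) | I ≠ ⊥}.Countable := by
    refine Set.MapsTo.countable_of_injOn (f := fun I => I.comap P.mkQ) (t := Set.Ioi P) ?_
      (Submodule.comap_injective_of_surjective P.mkQ_surjective).injOn
      (IsLocalRing.countable_Ioi_of_krullDimLE_one hP)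
    intro I hI
    refine lt_of_le_of_ne (P.le_comap_mkQ I) fun h => hI ?_
    have h2 : I.comap P.mkQ = (⊥ : Submodule R (R ⧸ P)).comap P.mkQ := by
      rw [← h]; exact (Submodule.ker_mkQ P).symm
    exact Submodule.comap_injective_of_surjective P.mkQ_surjective h2
  have h1 : {N : Submodule R M | N.comap f ≠ ⊥}.Countable := by
    refine (hI.biUnion (t := fun I _ => Set.Ici (I.map f)) fun I hI => hM _ ?_).mono ?_
    · rw [Ne, ← LinearMap.le_ker_iff_map, LinearMap.ker_eq_bot.2 hf, le_bot_iff]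
      exact hI
    · intro N hN
      exact Set.mem_biUnion (show N.comap f ∈ _ from hN) (Submodule.map_comap_le f N)
  have h2 : {N : Submodule R M | N.comap f = ⊥}.Countable := by
    -- Sort the submodules `N` with `N ∩ K = 0` by `L = N + K`, in which `N` is a complement of `K`.
    refine ((hM K hK0).biUnion
      (t := fun L _ => {N | N.comap f = ⊥ ∧ N ⊔ K = L}) fun L hL => ?_).mono ?_
    · have hKL : K ≤ L := hL
      let e : (R ⧸ P) ≃ₗ[R] K.submoduleOf L :=
        (LinearEquiv.ofInjective f hf).trans (Submodule.submoduleOfEquivOfLe hKL).symm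
      have := IsLocalRing.countable_isCompl hP e fun h1 h2 => h h1 h2.of_submodule
      refine Set.MapsTo.countable_of_injOn (f := fun N => N.submoduleOf L)
        (t := {q | IsCompl (K.submoduleOf L) q}) ?_ ?_ this
      · rintro N ⟨h1, rfl⟩
        constructor
        · rw [disjoint_iff, eq_bot_iff]
          rintro ⟨_, _⟩ ⟨⟨y, rfl⟩, h3⟩
          have : y ∈ N.comap f := h3
          rw [h1, Submodule.mem_bot] at this
          simp [this]
        · rw [codisjoint_iff, eq_top_iff]
          rintro ⟨x, hx⟩ -
          obtain ⟨n, hn, k, hk, rfl⟩ := Submodule.mem_sup.1 hx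
          refine Submodule.mem_sup.2 ⟨⟨k, Submodule.mem_sup_right hk⟩, hk,
            ⟨n, Submodule.mem_sup_left hn⟩, hn, ?_⟩
          ext
          exact add_comm _ _
      · rintro N ⟨-, h1⟩ N' ⟨-, h2⟩ h3
        have h4 : N ≤ L := h1 ▸ le_sup_left
        have h5 : N' ≤ L := h2 ▸ le_sup_left
        have := congrArg (Submodule.map L.subtype) h3
        simpa [Submodule.submoduleOf, Submodule.map_comap_subtype, h4, h5] using this
    · intro N hN
      exact Set.mem_biUnion (show N ⊔ K ∈ Set.Ici K from Set.mem_Ici.2 le_sup_right) ⟨hN, rfl⟩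
  rw [← Set.countable_univ_iff]
  refine (h1.union h2).mono fun N _ => ?_
  exact (ne_or_eq (N.comap f) ⊥)

theorem IsLocalRing.countable_submodule {R M : Type*} [CommRing R] [IsLocalRing R]
    [IsNoetherianRing R] [Countable (IsLocalRing.ResidueField R)] [AddCommGroup M] [Module R M]
    [Module.Finite R M] (h1 : Module.supportDim R M ≤ 1)
    (h2 : ∀ P : Ideal R, P.IsPrime → ringKrullDim (R ⧸ P) = 1 →
      ¬ IsSubquotient R ((R ⧸ P) × (R ⧸ P)) M) : Countable (Submodule R M) := by
  -- Noetherian induction from above: nonzero submodules of `M ⧸ N` correspond to submodules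
  -- strictly containing `N`.
  have key : ∀ N : Submodule R M, (Set.Ici N).Countable := by
    intro N
    induction N using WellFoundedGT.induction with
    | ind N ih =>
    suffices Countable (Submodule R (M ⧸ N)) from
      (Submodule.comapMkQRelIso N).symm.injective.countable
    rcases subsingleton_or_nontrivial (M ⧸ N) with hs | hs
    · infer_instance
    obtain ⟨P, hP⟩ := associatedPrimes.nonempty R (M ⧸ N)
    obtain ⟨hPp, f, hf⟩ := (isAssociatedPrime_iff_exists_injective_linearMap _ _).1
      (AssociatedPrimes.mem_iff.1 hP)
    have hdim : Ring.KrullDimLE 1 (R ⧸ P) := by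
      rw [Ring.krullDimLE_iff, ← Module.supportDim_quotient_eq_ringKrullDim]
      exact (Module.supportDim_le_of_injective f hf).trans
        ((Module.supportDim_le_of_surjective _ N.mkQ_surjective).trans h1)
    refine IsLocalRing.countable_submodule_of_countable_Ici hdim f hf
      (fun hd hq => h2 P hPp hd hq.of_quotient) fun K hK => ?_
    have hlt : N < K.comap N.mkQ := by
      refine lt_of_le_of_ne (N.le_comap_mkQ K) fun h => hK ?_
      refine Submodule.comap_injective_of_surjective N.mkQ_surjective ?_
      rw [← h]
      exact (Submodule.ker_mkQ N).symm
    exact Set.MapsTo.countable_of_injOn (f := fun I => I.comap N.mkQ)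
      (fun I hI => Submodule.comap_mono hI)
      (Submodule.comap_injective_of_surjective N.mkQ_surjective).injOn (ih _ hlt)
  exact Set.countable_univ_iff.1 ((key ⊥).mono fun N _ => Set.mem_Ici.2 bot_le)

theorem theorem1p2 {R : Type*} [CommRing R] [IsNoetherianRing R] [IsLocalRing R]
    [IsAdicComplete (IsLocalRing.maximalIdeal R) R]
    [Countable (IsLocalRing.ResidueField R)]
    {M : Type*} [AddCommGroup M] [Module R M] [Module.Finite R M] :
    (Countable (Submodule R M) ↔
      (Module.supportDim R M ≤ 1 ∧
        ∀ P : Ideal R, P.IsPrime → ringKrullDim (R ⧸ P) = 1 →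
          ¬ IsSubquotient R ((R ⧸ P) × (R ⧸ P)) M)) ∧
    (¬ (Module.supportDim R M ≤ 1 ∧
        ∀ P : Ideal R, P.IsPrime → ringKrullDim (R ⧸ P) = 1 →
          ¬ IsSubquotient R ((R ⧸ P) × (R ⧸ P)) M) →
      Cardinal.mk (Submodule R M) = Cardinal.continuum) := by
  have key : ¬ (Module.supportDim R M ≤ 1 ∧
        ∀ P : Ideal R, P.IsPrime → ringKrullDim (R ⧸ P) = 1 →
          ¬ IsSubquotient R ((R ⧸ P) × (R ⧸ P)) M) →
      Cardinal.mk (Submodule R M) = Cardinal.continuum := by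
    intro h
    refine le_antisymm IsLocalRing.mk_submodule_le_continuum ?_
    by_cases h1 : Module.supportDim R M ≤ 1
    · have h2 := not_and.1 h h1
      push Not at h2
      obtain ⟨P, hP, hd, hq⟩ := h2
      have hne : P ≠ IsLocalRing.maximalIdeal R := by
        rintro rfl
        have := ringKrullDim_eq_zero_of_field (IsLocalRing.ResidueField R)
        exact zero_ne_one (this.symm.trans hd)
      obtain ⟨f, hf⟩ := IsLocalRing.exists_injective_submodule_prod hne
      obtain ⟨g, hg⟩ := hq.exists_submodule_injective
      exact Cardinal.continuum_le_mk_of_injective (hg.comp hf)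
    · obtain ⟨P, hP, hq, hd⟩ := Module.exists_isSubquotient_not_krullDimLE_one h1
      obtain ⟨f, hf⟩ := IsLocalRing.exists_injective_submodule_of_not_krullDimLE hd
      obtain ⟨g, hg⟩ := hq.exists_submodule_injective
      exact Cardinal.continuum_le_mk_of_injective (hg.comp hf)
  refine ⟨⟨fun hc => ?_, fun h => IsLocalRing.countable_submodule h.1 h.2⟩, key⟩
  by_contra h
  have h2 := Cardinal.mk_le_aleph0_iff.2 hc
  rw [key h] at h2
  exact h2.not_gt Cardinal.aleph0_lt_continuum
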